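/- Let $X$ be a compact metric space with metric $d$, let $G$ be an infinite discrete group acting continuously on $X$, and suppose that the system $(X,G)$ is minimal (every orbit is dense) and admits a $G$-invariant Borel probability measure. A subset of $G$ is an IP-set if it contains, for some infinite sequence $(p_i)_{i\ge 1}$ in $G$, all products $\prod_{i\in\alpha}p_i$ (taken in increasing order of indices) with $\alpha\subset\mathbb N$ finite and non-empty; it is an IP$^*$-set if it meets every IP-set. A point $x\in X$ is pairwise IP$^*$-equicontinuous if for every $\varepsilon>0$ there is a neighbourhood $U$ of $x$ such that for all $y,z\in U$ the set $\{g\in G: d(gy,gz)<\varepsilon\}$ is an IP$^*$-set. A system $(Y,G)$ on a compact metric space is distal if $\inf_{g\in G}d(gy_1,gy_2)>0$ for all $y_1\ne y_2$ in $Y$. A factor map is a continuous $G$-equivariant surjection. Let $\pi\colon (X,G)\to(X_d,G)$ be the maximal distal factor of $(X,G)$, that is, the distal factor through which every factor map from $(X,G)$ to a distal system factors. The distal structure relation is $S_d=\{(x,y)\in X\times X:\pi(x)=\pi(y)\}$ (equivalently, $(x,y)\in S_d$ if and only if every factor map from $(X,G)$ to a distal system identifies $x$ and $y$), and $S_d(x)=\{y\in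 X:(x,y)\in S_d\}$. Then a point $x\in X$ is pairwise IP$^*$-equicontinuous if and only if $S_d(x)=\{x\}$. -/

import Mathlib

open Topology MeasureTheory

universe u v

/-- An IP-set in a group: a set containing all finite products (over non-empty finite sets of
indices, taken in increasing order of the indices) of some infinite sequence `p`. -/
def IsIPSet {G : Type v} [Group G] (F : Set G) : Prop :=
  ∃ p : Stream' G, Hindman.FP p ⊆ F

/-- An IP*-set: a set which meets every IP-set. -/
def IsIPStarSet {G : Type v} [Group G] (F : Set G) : Prop :=
  ∀ A : Set G, IsIPSet A → (F ∩ A).Nonempty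

/-- `x` is pairwise IP*-equicontinuous: for every `ε > 0` there is a neighbourhood `U` of `x` such
that for all `y, z ∈ U` the set of all `g` with `d(gy, gz) < ε` is an IP*-set. -/
def IsPairwiseIPStarEquicontinuousAt (G : Type v) {X : Type u} [Group G] [MetricSpace X]
    [MulAction G X] (x : X) : Prop :=
  ∀ ε : ℝ, 0 < ε → ∃ U ∈ 𝓝 x, ∀ y ∈ U, ∀ z ∈ U,
    IsIPStarSet {g : G | dist (g • y) (g • z) < ε}

/-- `(X, G)` is distal: any two distinct points form a distal pair. -/
def IsDistalSystem (G : Type v) (X : Type u) [Group G] [MetricSpace X] [MulAction G X] : Prop :=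
  ∀ x y : X, x ≠ y → 0 < ⨅ g : G, dist (g • x) (g • y)

/-- Factor maps: continuous equivariant surjections. -/
structure IsFactorMap (G : Type v) {X Y : Type u} [Group G] [TopologicalSpace X]
    [TopologicalSpace Y] [MulAction G X] [MulAction G Y] (π : X → Y) : Prop where
  continuous : Continuous π
  surjective : Function.Surjective π
  map_smul : ∀ (g : G) (x : X), π (g • x) = g • π x

/-- `π : X → Y` is a maximal distal factor of `(X, G)`: `(Y, G)` is a distal factor of `(X, G)`, and
every distal factor `φ : X → Z` of `(X, G)` is a factor of `(Y, G)`, compatibly with `π`. -/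
def IsMaximalDistalFactor (G : Type v) {X Y : Type u} [Group G] [MetricSpace X] [MulAction G X]
    [MetricSpace Y] [MulAction G Y] (π : X → Y) : Prop :=
  IsFactorMap G π ∧ IsDistalSystem G Y ∧
    ∀ (Z : Type u) [MetricSpace Z] [CompactSpace Z] [MulAction G Z] [ContinuousConstSMul G Z]
      (φ : X → Z), IsFactorMap G φ → IsDistalSystem G Z →
        ∃ ψ : Y → Z, IsFactorMap G ψ ∧ ψ ∘ π = φ

/-- The distal structure relation `S_d` of `(X, G)`: two points are related if and only if they are
identified by every distal factor of `(X, G)`. It is shown below that `S_d` is the relation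
`{(x, y) | π x = π y}` of a maximal distal factor `π`, and that of every maximal distal factor. -/
def distalStructureRelation (G : Type v) (X : Type u) [Group G] [MetricSpace X] [MulAction G X] :
    Setoid X where
  r x y := ∀ (Z : Type u) [MetricSpace Z] [CompactSpace Z] [MulAction G Z]
    [ContinuousConstSMul G Z] (φ : X → Z), IsFactorMap G φ → IsDistalSystem G Z → φ x = φ y
  iseqv :=
    { refl := fun _ _ _ _ _ _ _ _ _ => rfl
      symm := fun h Z _ _ _ _ φ hφ hZ => (h Z φ hφ hZ).symm
      trans := fun h h' Z _ _ _ _ φ hφ hZ => (h Z φ hφ hZ).trans (h' Z φ hφ hZ) }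

/-- A maximal distal factor induces the distal structure relation. -/
theorem IsMaximalDistalFactor.rel_iff {G : Type v} {X Y : Type u} [Group G] [MetricSpace X]
    [MulAction G X] [MetricSpace Y] [CompactSpace Y] [MulAction G Y] [ContinuousConstSMul G Y]
    {π : X → Y} (h : IsMaximalDistalFactor G π) (x y : X) :
    (distalStructureRelation G X) x y ↔ π x = π y := by
  constructor
  · intro hxy
    exact hxy Y π h.1 h.2.1
  · intro hxy Z _ _ _ _ φ hφ hZ
    obtain ⟨ψ, -, rfl⟩ := h.2.2 Z φ hφ hZ
    simp [hxy]

/-- Distality of a pair is reflected by continuous equivariant maps. -/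
theorem distal_pair_of_map {G : Type v} {Y Z : Type u} [Group G] [MetricSpace Y] [CompactSpace Y]
    [MulAction G Y] [MetricSpace Z] [MulAction G Z] {f : Y → Z} (hf : Continuous f)
    (hs : ∀ (g : G) (y : Y), f (g • y) = g • f y) {a b : Y}
    (h : 0 < ⨅ g : G, dist (g • f a) (g • f b)) : 0 < ⨅ g : G, dist (g • a) (g • b) := by
  obtain ⟨δ, hδ, H⟩ := Metric.uniformContinuous_iff.1
    (CompactSpace.uniformContinuous_of_continuous hf) _ h
  refine lt_of_lt_of_le hδ (le_ciInf fun g => ?_)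
  by_contra hlt
  have h1 := H (not_le.1 hlt)
  rw [hs, hs] at h1
  have h2 : (⨅ g : G, dist (g • f a) (g • f b)) ≤ dist (g • f a) (g • f b) :=
    ciInf_le ⟨0, by rintro _ ⟨g, rfl⟩; exact dist_nonneg⟩ g
  exact absurd h1 (not_lt.2 h2)

/-- Every system has a maximal distal factor, and it is the quotient by the distal structure
relation. -/
theorem exists_isMaximalDistalFactor (G : Type v) (X : Type u) [Group G] [MetricSpace X]
    [CompactSpace X] [MulAction G X] [ContinuousConstSMul G X] :
    ∃ (Y : Type u) (_ : MetricSpace Y) (_ : CompactSpace Y) (_ : MulAction G Y)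
      (_ : ContinuousConstSMul G Y) (π : X → Y), IsMaximalDistalFactor G π ∧
        ∀ x y : X, (distalStructureRelation G X) x y ↔ π x = π y := by
  classical
  set N : Set (X × X) := {p | ¬ (distalStructureRelation G X) p.1 p.2} with hN
  have h1 : ∀ p : N, ∃ (Z : Type u) (_ : MetricSpace Z) (_ : CompactSpace Z) (_ : MulAction G Z)
      (_ : ContinuousConstSMul G Z) (φ : X → Z), IsFactorMap G φ ∧ IsDistalSystem G Z ∧
        φ p.1.1 ≠ φ p.1.2 := by
    rintro ⟨p, hp⟩
    by_contra hcon
    apply hp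
    intro Z _ _ _ _ φ hφ hZ
    by_contra hne
    exact hcon ⟨Z, _, ‹_›, _, ‹_›, φ, hφ, hZ, hne⟩
  choose Z mZ cZ aZ sZ φ hφ hZ hne using h1
  let W : N → Set (X × X) := fun p => {q | φ p q.1 ≠ φ p q.2}
  have hW : ∀ p, IsOpen (W p) := fun p =>
    isOpen_ne_fun ((hφ p).continuous.comp continuous_fst) ((hφ p).continuous.comp continuous_snd)
  obtain ⟨T, hTc, hT⟩ := TopologicalSpace.isOpen_iUnion_countable W hW
  have : Countable T := hTc
  let P : Type u := ∀ t : T, Z t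
  have : Continuous fun (x : X) (t : T) => φ t x := continuous_pi fun t => (hφ t).continuous
  let F : X → P := fun x t => φ t x
  have hF : Continuous F := this
  have hFs : ∀ (g : G) x, F (g • x) = g • F x := fun g x => funext fun t => (hφ t).map_smul g x
  let Y : Type u := Set.range F
  let mY : MetricSpace Y := TopologicalSpace.metrizableSpaceMetric Y
  have cY : CompactSpace Y := isCompact_iff_compactSpace.1 (isCompact_range hF)
  let aY : MulAction G Y :=
    { smul := fun g y => ⟨g • y.1, by obtain ⟨_, x, rfl⟩ := y; exact ⟨g • x, hFs g x⟩⟩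
      one_smul := fun y => Subtype.ext (one_smul G y.1)
      mul_smul := fun g h y => Subtype.ext (mul_smul g h y.1) }
  have sY : ContinuousConstSMul G Y :=
    ⟨fun g => Continuous.subtype_mk ((continuous_const_smul g).comp continuous_subtype_val) _⟩
  let π : X → Y := fun x => ⟨F x, x, rfl⟩
  have hπ : IsFactorMap G π :=
    ⟨hF.subtype_mk _, by rintro ⟨_, x, rfl⟩; exact ⟨x, rfl⟩, fun g x => Subtype.ext (hFs g x)⟩
  have hd : IsDistalSystem G Y := by
    intro a b hab
    have : ∃ t : T, a.1 t ≠ b.1 t := by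
      by_contra hcon
      push Not at hcon
      exact hab (Subtype.ext (funext hcon))
    obtain ⟨t, ht⟩ := this
    let f : Y → Z t := fun y => y.1 t
    have hf : Continuous f := (continuous_apply t).comp continuous_subtype_val
    exact distal_pair_of_map (f := f) hf
      (fun g y => rfl) (hZ t _ _ ht)
  have hrel : ∀ x y : X, π x = π y → (distalStructureRelation G X) x y := by
    intro x y hxy
    by_contra hcon
    have hm : (x, y) ∈ ⋃ p, W p := Set.mem_iUnion.2 ⟨⟨(x, y), hcon⟩, hne _⟩
    rw [← hT] at hm
    simp only [Set.mem_iUnion] at hm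
    obtain ⟨t, ht, hq⟩ := hm
    exact hq (congrFun (congrArg Subtype.val hxy) ⟨t, ht⟩)
  have hmax : IsMaximalDistalFactor G π := by
    refine ⟨hπ, hd, ?_⟩
    intro V _ _ _ _ θ hθ hV
    have hq : IsQuotientMap π := IsQuotientMap.of_surjective_continuous hπ.surjective hπ.continuous
    choose s hs using hπ.surjective
    have hc : (fun y => θ (s y)) ∘ π = θ :=
      funext fun x => hrel _ _ (hs (π x)) V θ hθ hV
    refine ⟨fun y => θ (s y), ⟨?_, ?_, ?_⟩, hc⟩
    · rw [hq.continuous_iff, hc]; exact hθ.continuous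
    · intro v
      obtain ⟨x, rfl⟩ := hθ.surjective v
      exact ⟨π x, congrFun hc x⟩
    · intro g y
      obtain ⟨x, rfl⟩ := hπ.surjective y
      have e1 := congrFun hc (g • x)
      have e2 := congrFun hc x
      simp only [Function.comp_apply] at e1 e2
      rw [← hπ.map_smul, e1, e2, hθ.map_smul]
  exact ⟨Y, mY, cY, aY, sY, π, hmax, fun x y => hmax.rel_iff x y⟩

/-! By Hindman's theorem, IP*-sets are exactly the sets lying in every idempotent ultrafilter, so
the condition at `x` compares limits of nearby orbits along idempotents. If `x` is alone in its
fibre over a distal factor, then small neighbourhoods of `x` contain whole fibres. Idempotents fix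
every point of a distal system, so upstairs they move points only within fibres, and limits of
points near `x` stay near `x`. Conversely, idempotents fix an equicontinuity point `x`. If one moved
`x` to `y ≠ x`, Poincaré recurrence (`exists_FP_subset_and_smul_mem`) would give a point near `x`
returning near `x` along an IP-set that keeps `x` near `y`. In a minimal system, if `y` and `z` are
proximal, some idempotent sends both to `z`; hence points proximal to points near `x` are near `x`.
Minimality spreads this smallness from `x` to all of `X`: proximality is a closed equivalence
relation with distal quotient. The class of `x` is trivial, so that quotient separates `x` from
every other point. -/

open Filter Hindman

attribute [local instance] Ultrafilter.semigroup

/-! ### Quotients of compact metrizable spaces. -/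

section QuotientTopology

variable {X : Type u} [TopologicalSpace X] [CompactSpace X]

/-- The quotient map of a compact space by a closed equivalence relation is closed. -/
theorem isClosedMap_quotientMk_of_isClosed (s : Setoid X)
    (hs : IsClosed {q : X × X | s q.1 q.2}) : IsClosedMap (Quotient.mk s) := by
  intro C hC
  refine (isQuotientMap_quotient_mk' (s := s)).isClosed_preimage.1 ?_
  have : Quotient.mk s ⁻¹' (Quotient.mk s '' C) =
      Prod.snd '' ({q : X × X | s q.1 q.2} ∩ Prod.fst ⁻¹' C) := by
    ext y
    constructor
    · rintro ⟨c, hc, hcy⟩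
      exact ⟨(c, y), ⟨Quotient.exact hcy, hc⟩, rfl⟩
    · rintro ⟨⟨c, z⟩, ⟨hcz, hc⟩, rfl⟩
      exact ⟨c, hc, Quotient.sound hcz⟩
  change IsClosed (Quotient.mk s ⁻¹' (Quotient.mk s '' C))
  rw [this]
  exact isClosedMap_snd_of_compactSpace _ (hs.inter (hC.preimage continuous_fst))

/-- The quotient of a compact Hausdorff space by a closed equivalence relation is Hausdorff. -/
theorem t2Space_quotient_of_isClosed [T2Space X] (s : Setoid X)
    (hs : IsClosed {q : X × X | s q.1 q.2}) : T2Space (Quotient s) := by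
  have hcl := isClosedMap_quotientMk_of_isClosed s hs
  have hct : Continuous (Quotient.mk s) := continuous_quotient_mk'
  have hfib : ∀ y : Quotient s, IsClosed (Quotient.mk s ⁻¹' {y}) := by
    intro y
    obtain ⟨a, rfl⟩ := Quotient.exists_rep y
    refine IsClosed.preimage hct ?_
    simpa using hcl _ (isClosed_singleton (x := a))
  refine ⟨fun y z hyz => ?_⟩
  obtain ⟨U, V, hU, hV, hyU, hzV, hUV⟩ := normal_separation (hfib y) (hfib z)
    (Set.disjoint_left.2 fun a hay haz => hyz (hay.symm.trans haz))
  -- The points whose whole fibre lies in `U` form an open set, since the quotient map is closed.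
  refine ⟨Set.kernImage (Quotient.mk s) U, Set.kernImage (Quotient.mk s) V,
    isClosedMap_iff_kernImage.1 hcl hU, isClosedMap_iff_kernImage.1 hcl hV,
    fun a ha => hyU ha, fun a ha => hzV ha, Set.disjoint_left.2 fun w hw hw' => ?_⟩
  obtain ⟨a, rfl⟩ := Quotient.exists_rep w
  exact Set.disjoint_left.1 hUV (hw rfl) (hw' rfl)

/-- A Hausdorff continuous image of a second countable compact space is second countable. -/
theorem secondCountableTopology_of_continuous_surjective [SecondCountableTopology X]
    {Y : Type u} [TopologicalSpace Y] [T2Space Y] {f : X → Y} (hf : Continuous f)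
    (hsurj : Function.Surjective f) : SecondCountableTopology Y := by
  let B := TopologicalSpace.countableBasis X
  have hB := TopologicalSpace.isBasis_countableBasis X
  -- Finite unions are needed because a compact fibre need not fit in one basic open set.
  let S : Set (Set Y) := (fun F => Set.kernImage f (⋃₀ F)) '' {F | F.Finite ∧ F ⊆ B}
  have hS : S.Countable :=
    (Set.countable_ofPred_finite_subset (TopologicalSpace.countable_countableBasis X)).image _
  refine TopologicalSpace.IsTopologicalBasis.secondCountableTopology (b := S) ?_ hS
  refine TopologicalSpace.isTopologicalBasis_of_isOpen_of_nhds ?_ ?_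
  · rintro _ ⟨F, ⟨-, hF⟩, rfl⟩
    exact isClosedMap_iff_kernImage.1 hf.isClosedMap
      (isOpen_sUnion fun t ht => hB.isOpen (hF ht))
  · intro y O hy hO
    have hK : IsCompact (f ⁻¹' {y}) := (isClosed_singleton.preimage hf).isCompact
    obtain ⟨F, hFf, hFB, hyF, hFO⟩ : ∃ F : Set (Set X), F.Finite ∧ F ⊆ B ∧
        f ⁻¹' {y} ⊆ ⋃₀ F ∧ ⋃₀ F ⊆ f ⁻¹' O := by
      refine hK.induction_on (p := fun K => ∃ F : Set (Set X), F.Finite ∧ F ⊆ B ∧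
        K ⊆ ⋃₀ F ∧ ⋃₀ F ⊆ f ⁻¹' O) ?_ ?_ ?_ ?_
      · exact ⟨∅, Set.finite_empty, Set.empty_subset _, Set.empty_subset _, by simp⟩
      · rintro s t hst ⟨F, h1, h2, h3, h4⟩
        exact ⟨F, h1, h2, hst.trans h3, h4⟩
      · rintro s t ⟨F, h1, h2, h3, h4⟩ ⟨F', h1', h2', h3', h4'⟩
        refine ⟨F ∪ F', h1.union h1', Set.union_subset h2 h2', ?_, ?_⟩
        · rw [Set.sUnion_union]; exact Set.union_subset_union h3 h3'
        · rw [Set.sUnion_union]; exact Set.union_subset h4 h4'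
      · intro a ha
        obtain ⟨b, hb, hab, hbO⟩ := hB.exists_subset_of_mem_open
          (show a ∈ f ⁻¹' O by rw [Set.mem_preimage, show f a = y from ha]; exact hy)
          (hO.preimage hf)
        exact ⟨b, mem_nhdsWithin_of_mem_nhds ((hB.isOpen hb).mem_nhds hab), {b},
          Set.finite_singleton b, by simpa using hb, by simp, by simpa using hbO⟩
    refine ⟨_, ⟨F, ⟨hFf, hFB⟩, rfl⟩, fun a ha => hyF ha, fun w hw => ?_⟩
    obtain ⟨a, rfl⟩ := hsurj w
    exact hFO (hw rfl)

end QuotientTopology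

/-! ### Ultrafilters on the group acting by limits. -/

section UltrafilterLimits

variable {G : Type v} [Group G] {X : Type u} [MetricSpace X] [MulAction G X]

theorem exists_tendsto_smul_ultrafilter [CompactSpace X] (p : Ultrafilter G) (a : X) :
    ∃ z, Tendsto (fun g : G => g • a) p (𝓝 z) := by
  obtain ⟨z, -, hz⟩ := isCompact_univ.ultrafilter_le_nhds (p.map fun g : G => g • a) (by simp)
  exact ⟨z, hz⟩

theorem exists_ultrafilter_tendsto_smul [MulAction.IsMinimal G X] (a b : X) :
    ∃ p : Ultrafilter G, Tendsto (fun g : G => g • a) p (𝓝 b) := by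
  have hne : (comap (fun g : G => g • a) (𝓝 b)).NeBot := by
    refine comap_neBot fun t ht => ?_
    obtain ⟨W, hWt, hW, hb⟩ := mem_nhds_iff.1 ht
    obtain ⟨g, hg⟩ := hW.exists_smul_mem G a ⟨b, hb⟩
    exact ⟨g, hWt hg⟩
  exact ⟨Ultrafilter.of _, tendsto_comap.mono_left (Ultrafilter.of_le _)⟩

variable [ContinuousConstSMul G X]

/-- Limits compose, `q` acting first; only the continuity of each single group element is used. -/
theorem tendsto_smul_ultrafilter_mul {p q : Ultrafilter G} {a b c : X}
    (hq : Tendsto (fun g : G => g • a) q (𝓝 b)) (hp : Tendsto (fun g : G => g • b) p (𝓝 c)) :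
    Tendsto (fun g : G => g • a) ((p * q : Ultrafilter G) : Filter G) (𝓝 c) := by
  refine (nhds_basis_opens c).tendsto_right_iff.2 fun W ⟨hc, hW⟩ => ?_
  rw [Ultrafilter.eventually_mul]
  filter_upwards [hp.eventually (hW.mem_nhds hc)] with m hm
  filter_upwards [(hq.const_smul m).eventually (hW.mem_nhds hm)] with n hn
  rwa [mul_smul]

end UltrafilterLimits

/-! ### Proximality and idempotents. -/

section Proximality

variable {G : Type v} [Group G] {X : Type u} [MetricSpace X] [MulAction G X]

/-- Two points are proximal if their translates have a common limit along some ultrafilter. -/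
def IsProximalPair (G : Type v) {X : Type u} [Group G] [MetricSpace X] [MulAction G X]
    (a b : X) : Prop :=
  ∃ (p : Ultrafilter G) (z : X),
    Tendsto (fun g : G => g • a) p (𝓝 z) ∧ Tendsto (fun g : G => g • b) p (𝓝 z)

theorem IsProximalPair.iInf_dist_eq_zero {a b : X} (h : IsProximalPair G a b) :
    ⨅ g : G, dist (g • a) (g • b) = 0 := by
  obtain ⟨p, z, ha, hb⟩ := h
  refine le_antisymm ?_ (Real.iInf_nonneg fun _ => dist_nonneg)
  have hlim := ha.dist hb
  rw [dist_self] at hlim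
  exact ge_of_tendsto hlim (Eventually.of_forall fun g =>
    ciInf_le ⟨0, by rintro _ ⟨g, rfl⟩; exact dist_nonneg⟩ g)

theorem isProximalPair_of_iInf_dist_nonpos [CompactSpace X] {a b : X}
    (h : ¬ 0 < ⨅ g : G, dist (g • a) (g • b)) : IsProximalPair G a b := by
  have hne : (comap (fun g : G => dist (g • a) (g • b)) (𝓝 0)).NeBot := by
    refine comap_neBot fun t ht => ?_
    obtain ⟨ε, hε, ht⟩ := Metric.mem_nhds_iff.1 ht
    obtain ⟨g, hg⟩ := exists_lt_of_ciInf_lt (lt_of_le_of_lt (not_lt.1 h) hε)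
    exact ⟨g, ht (by simpa [abs_of_nonneg dist_nonneg] using hg)⟩
  let p := Ultrafilter.of (comap (fun g : G => dist (g • a) (g • b)) (𝓝 0))
  have hp : Tendsto (fun g : G => dist (g • a) (g • b)) p (𝓝 0) :=
    tendsto_comap.mono_left (Ultrafilter.of_le _)
  obtain ⟨y, hy⟩ := exists_tendsto_smul_ultrafilter p a
  obtain ⟨z, hz⟩ := exists_tendsto_smul_ultrafilter p b
  have hyz : y = z := dist_eq_zero.1 (tendsto_nhds_unique (hy.dist hz) hp)
  exact ⟨p, z, hyz ▸ hy, hz⟩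

variable [ContinuousConstSMul G X]

theorem IsProximalPair.of_tendsto {a b a' b' : X} {p : Ultrafilter G}
    (ha : Tendsto (fun g : G => g • a) p (𝓝 a')) (hb : Tendsto (fun g : G => g • b) p (𝓝 b'))
    (h : IsProximalPair G a' b') : IsProximalPair G a b := by
  obtain ⟨q, z, ha', hb'⟩ := h
  exact ⟨q * p, z, tendsto_smul_ultrafilter_mul ha ha', tendsto_smul_ultrafilter_mul hb hb'⟩

theorem IsProximalPair.smul {a b : X} (h : IsProximalPair G a b) (g : G) :
    IsProximalPair G (g • a) (g • b) := by
  have key : ∀ c : X, Tendsto (fun k : G => k • g • c) (pure g⁻¹ : Ultrafilter G) (𝓝 c) := by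
    intro c
    rw [Ultrafilter.coe_pure, tendsto_pure_left]
    intro s hs
    rw [inv_smul_smul]
    exact mem_of_mem_nhds hs
  exact .of_tendsto (key a) (key b) h

/-- An idempotent ultrafilter moves every point to a point proximal to it. -/
theorem isProximalPair_of_tendsto_idempotent [CompactSpace X] {p : Ultrafilter G}
    (hp : p * p = p) {a b : X} (h : Tendsto (fun g : G => g • a) p (𝓝 b)) :
    IsProximalPair G a b := by
  obtain ⟨c, hc⟩ := exists_tendsto_smul_ultrafilter p b
  have h' := tendsto_smul_ultrafilter_mul h hc
  rw [hp] at h'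
  obtain rfl := tendsto_nhds_unique h h'
  exact ⟨p, b, h, hc⟩

/-- In a distal system idempotent ultrafilters act trivially. -/
theorem IsDistalSystem.eq_of_tendsto_idempotent [CompactSpace X] (hX : IsDistalSystem G X)
    {p : Ultrafilter G} (hp : p * p = p) {a b : X}
    (h : Tendsto (fun g : G => g • a) p (𝓝 b)) : b = a := by
  by_contra hne
  have := hX a b (Ne.symm hne)
  rw [(isProximalPair_of_tendsto_idempotent hp h).iInf_dist_eq_zero] at this
  exact lt_irrefl _ this

variable [MulAction.IsMinimal G X]

theorem IsProximalPair.exists_tendsto {a b : X} (h : IsProximalPair G a b) (z : X) :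
    ∃ p : Ultrafilter G,
      Tendsto (fun g : G => g • a) p (𝓝 z) ∧ Tendsto (fun g : G => g • b) p (𝓝 z) := by
  obtain ⟨p, w, ha, hb⟩ := h
  obtain ⟨q, hq⟩ := exists_ultrafilter_tendsto_smul (G := G) w z
  exact ⟨q * p, tendsto_smul_ultrafilter_mul ha hq, tendsto_smul_ultrafilter_mul hb hq⟩

/-- In a minimal system, proximal points are related by an idempotent ultrafilter. -/
theorem IsProximalPair.exists_idempotent [CompactSpace X] {a b : X} (h : IsProximalPair G a b) :
    ∃ p : Ultrafilter G, p * p = p ∧ Tendsto (fun g : G => g • a) p (𝓝 b) ∧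
      Tendsto (fun g : G => g • b) p (𝓝 b) := by
  -- A nonempty closed subsemigroup, by minimality and because its members fix `b`; Ellis's lemma
  -- gives an idempotent in it.
  let S : Set (Ultrafilter G) := {p | Tendsto (fun g : G => g • a) p (𝓝 b) ∧
      Tendsto (fun g : G => g • b) p (𝓝 b)}
  have hcl : ∀ c : X, IsClosed {p : Ultrafilter G | Tendsto (fun g : G => g • c) p (𝓝 b)} := by
    intro c
    have : {p : Ultrafilter G | Tendsto (fun g : G => g • c) p (𝓝 b)} =
        ⋂ s ∈ 𝓝 b, {p : Ultrafilter G | (fun g : G => g • c) ⁻¹' s ∈ p} := by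
      ext p
      simp only [Set.mem_iInter]
      exact Iff.rfl
    rw [this]
    exact isClosed_biInter fun s _ => ultrafilter_isClosed_basic _
  obtain ⟨p, hpS, hp⟩ := exists_idempotent_in_compact_subsemigroup
    Ultrafilter.continuous_mul_left S (h.exists_tendsto b)
    ((hcl a).inter (hcl b)).isCompact
    (fun p hp q hq => ⟨tendsto_smul_ultrafilter_mul hq.1 hp.2,
      tendsto_smul_ultrafilter_mul hq.2 hp.2⟩)
  exact ⟨p, hp, hpS.1, hpS.2⟩

end Proximality

/-! ### IP*-sets and idempotent ultrafilters. -/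

section IPStar

variable {G : Type v} [Group G]

/-- An IP*-set belongs to every idempotent ultrafilter. -/
theorem IsIPStarSet.mem_of_idempotent {F : Set G} (hF : IsIPStarSet F) {p : Ultrafilter G}
    (hp : p * p = p) : F ∈ p := by
  by_contra hcon
  obtain ⟨a, ha⟩ := exists_FP_of_large p hp Fᶜ (Ultrafilter.compl_mem_iff_notMem.2 hcon)
  obtain ⟨g, hgF, hga⟩ := hF (FP a) ⟨a, subset_rfl⟩
  exact ha hga hgF

/-- A set belonging to every idempotent ultrafilter is an IP*-set. -/
theorem isIPStarSet_of_forall_idempotent {F : Set G}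
    (hF : ∀ p : Ultrafilter G, p * p = p → F ∈ p) : IsIPStarSet F := by
  rintro A ⟨a, ha⟩
  obtain ⟨p, hp, hpa⟩ := exists_idempotent_ultrafilter_le_FP a
  exact Ultrafilter.nonempty_of_mem (inter_mem (hF p hp) (mem_of_superset hpa ha))

/-- The quotients of the partial products of a sequence are finite products of the sequence. -/
theorem exists_partialProducts (a : Stream' G) :
    ∃ P : ℕ → G, ∀ m n, m < n → (P m)⁻¹ * P n ∈ FP a := by
  -- `P n` multiplies the first `n` terms, so for `m < n` the quotient is the product of the terms
  -- from `m` to `n - 1`.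
  let P : ℕ → G := fun n => Nat.rec 1 (fun k x => x * a.get k) n
  have hP : ∀ k, P (k + 1) = P k * a.get k := fun k => rfl
  have hdrop : ∀ (k : ℕ) (b : Stream' G), FP (b.drop k) ⊆ FP b := by
    intro k
    induction k with
    | zero => intro b; exact subset_rfl
    | succ k ih =>
      intro b x hx
      exact FP.tail _ _ (ih b.tail hx)
  have key : ∀ k m, (P m)⁻¹ * P (m + k + 1) ∈ FP (a.drop m) := by
    intro k
    induction k with
    | zero =>
      intro m
      have : (P m)⁻¹ * P (m + 0 + 1) = (a.drop m).head := by
        simp [hP]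
      rw [this]
      exact FP.head _
    | succ k ih =>
      intro m
      have : (P m)⁻¹ * P (m + (k + 1) + 1) =
          (a.drop m).head * ((P (m + 1))⁻¹ * P (m + 1 + k + 1)) := by
        rw [hP m, Stream'.head_drop, show m + (k + 1) + 1 = m + 1 + k + 1 by ring]
        group
      rw [this]
      refine FP.cons _ _ ?_
      have h := ih (m + 1)
      rwa [← Stream'.tail_drop'] at h
  refine ⟨P, fun m n hmn => ?_⟩
  obtain ⟨k, rfl⟩ := Nat.exists_eq_add_of_lt hmn
  exact hdrop m a (key k m)

end IPStar

/-! ### Measure-theoretic recurrence along IP-sets. -/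

section Recurrence

variable {G : Type v} [Group G] {X : Type u} [TopologicalSpace X] [MulAction G X]
  [ContinuousConstSMul G X] [MeasurableSpace X] [BorelSpace X]

/-- Poincaré recurrence along idempotent ultrafilters. -/
theorem eventually_measure_inter_preimage_smul_ne_zero (μ : Measure X) [IsFiniteMeasure μ]
    [SMulInvariantMeasure G X μ] {p : Ultrafilter G} (hp : p * p = p) {C : Set X}
    (hC : MeasurableSet C) (hμC : μ C ≠ 0) :
    ∀ᶠ h in (p : Filter G), μ (C ∩ (fun x => h • x) ⁻¹' C) ≠ 0 := by
  by_contra hcon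
  rw [← Ultrafilter.eventually_not] at hcon
  obtain ⟨a, ha⟩ := exists_FP_of_large p hp _ hcon
  obtain ⟨P, hP⟩ := exists_partialProducts a
  -- If recurrence failed, the translates `P n • C` would be almost disjoint with equal positive
  -- measure, contradicting finiteness.
  let f : ℕ → Set X := fun n => (fun x => (P n)⁻¹ • x) ⁻¹' C
  have hf : ∀ n, MeasurableSet (f n) := fun n => measurable_const_smul _ hC
  have hlt : ∀ m n, m < n → μ (f m ∩ f n) = 0 := by
    intro m n hmn
    have h0 := not_not.1 (ha (hP m n hmn))
    have : f m ∩ f n = (fun x => (P n)⁻¹ • x) ⁻¹'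
        (C ∩ (fun x => ((P m)⁻¹ * P n) • x) ⁻¹' C) := by
      ext x
      simp only [f, Set.mem_inter_iff, Set.mem_preimage, mul_smul, smul_inv_smul]
      exact and_comm
    rw [this, measure_preimage_smul, h0]
  have hd : Pairwise (Function.onFun (AEDisjoint μ) f) := by
    intro m n hmn
    rcases lt_or_gt_of_ne hmn with h | h
    · exact hlt m n h
    · exact (Set.inter_comm _ _ ▸ hlt n m h :)
  have hU := measure_iUnion₀ hd fun n => (hf n).nullMeasurableSet
  have hfC : ∀ n, μ (f n) = μ C := fun n => measure_preimage_smul _ _ _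
  simp only [hfC] at hU
  rw [ENNReal.tsum_const_eq_top_of_ne_zero hμC] at hU
  exact measure_ne_top μ _ hU

/-- IP-recurrence: a closed set of positive measure contains a point which returns to it along an
IP-set contained in a prescribed member of an idempotent ultrafilter. -/
theorem exists_FP_subset_and_smul_mem [CompactSpace X] (μ : Measure X) [IsFiniteMeasure μ]
    [SMulInvariantMeasure G X μ] {p : Ultrafilter G} (hp : p * p = p) {A : Set G} (hA : A ∈ p)
    {C : Set X} (hC : IsClosed C) (hμC : μ C ≠ 0) :
    ∃ a : Stream' G, FP a ⊆ A ∧ ∃ y ∈ C, ∀ g ∈ FP a, g • y ∈ C := by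
  -- The Galvin–Glazer construction, shrinking a closed set of positive measure along with the large
  -- set of group elements.
  let σ := {q : Set G × Set X // q.1 ∈ p ∧ IsClosed q.2 ∧ μ q.2 ≠ 0}
  have step : ∀ q : σ, ∃ (h : G) (r : σ), h ∈ q.1.1 ∧ (r.1.1 ⊆ q.1.1 ∩ {m | h * m ∈ q.1.1}) ∧
      r.1.2 ⊆ q.1.2 ∩ (fun x => h • x) ⁻¹' q.1.2 := by
    rintro ⟨⟨s, D⟩, hs, hD, hμD⟩
    have h1 : ∀ᶠ h in (p : Filter G), ∀ᶠ m in (p : Filter G), h * m ∈ s := by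
      rw [← Ultrafilter.eventually_mul, hp]
      exact hs
    have h2 := eventually_measure_inter_preimage_smul_ne_zero μ hp hD.measurableSet hμD
    have h3 : ∀ᶠ h in (p : Filter G), h ∈ s := hs
    obtain ⟨h, h1, h2, h3⟩ := (h1.and (h2.and h3)).exists
    exact ⟨h, ⟨(s ∩ {m | h * m ∈ s}, D ∩ (fun x => h • x) ⁻¹' D), inter_mem hs h1,
      hD.inter (hD.preimage (continuous_const_smul h)), h2⟩, h3, subset_rfl, subset_rfl⟩
  choose h nxt hh hnxt hnxt' using step
  let D : σ → Set X := fun q => ⋂ n, (nxt^[n] q).1.2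
  have hDtail : ∀ q, D q ⊆ D (nxt q) := fun q y hy =>
    Set.mem_iInter.2 fun n => Set.mem_iInter.1 hy (n + 1)
  have hDhead : ∀ q, D q ⊆ q.1.2 := fun q y hy => Set.mem_iInter.1 hy 0
  have key : ∀ (b : Stream' G) (m : G), m ∈ FP b → ∀ q : σ, (∀ n, b.get n = h (nxt^[n] q)) →
      m ∈ q.1.1 ∧ ∀ y ∈ D q, m • y ∈ q.1.2 := by
    intro b m hm
    induction hm with
    | head' b =>
      intro q hq
      have hb : b.head = h q := hq 0
      rw [hb]
      exact ⟨hh q, fun y hy => (hnxt' q (hDhead _ (hDtail q hy))).2⟩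
    | tail' b m _ ih =>
      intro q hq
      obtain ⟨h1, h2⟩ := ih (nxt q) fun n => hq (n + 1)
      exact ⟨(hnxt q h1).1, fun y hy => (hnxt' q (h2 y (hDtail q hy))).1⟩
    | cons' b m _ ih =>
      intro q hq
      have hb : b.head = h q := hq 0
      obtain ⟨h1, h2⟩ := ih (nxt q) fun n => hq (n + 1)
      rw [hb]
      refine ⟨(hnxt q h1).2, fun y hy => ?_⟩
      rw [mul_smul]
      exact (hnxt' q (h2 y (hDtail q hy))).2
  let q₀ : σ := ⟨(A, C), hA, hC, hμC⟩
  -- Compactness gives one point valid at every stage; products apply their later factors first, so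
  -- they descend through the nested sets.
  obtain ⟨y, hy⟩ : (D q₀).Nonempty := by
    refine IsCompact.nonempty_iInter_of_sequence_nonempty_isCompact_isClosed _ (fun n => ?_)
      (fun n => nonempty_of_measure_ne_zero (nxt^[n] q₀).2.2.2)
      (nxt^[0] q₀).2.2.1.isCompact (fun n => (nxt^[n] q₀).2.2.1)
    rw [Function.iterate_succ_apply']
    exact (hnxt' _).trans Set.inter_subset_left
  let a : Stream' G := fun n => h (nxt^[n] q₀)
  exact ⟨a, fun m hm => (key a m hm q₀ fun _ => rfl).1, y, hDhead _ hy,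
    fun m hm => (key a m hm q₀ fun _ => rfl).2 y hy⟩

end Recurrence

/-! ### Small proximal cells and the distal quotient. -/

theorem eq_of_isProximalPair {G : Type v} [Group G] {X : Type u} [MetricSpace X] [MulAction G X]
    {x : X} (hx : ∀ ε : ℝ, 0 < ε →
      ∃ U ∈ 𝓝 x, ∀ y ∈ U, ∀ z, IsProximalPair G y z → dist z x ≤ ε)
    {z : X} (h : IsProximalPair G x z) : z = x := by
  refine dist_le_zero.1 (le_of_forall_pos_le_add fun ε hε => ?_)
  obtain ⟨U, hU, hxU⟩ := hx ε hε
  simpa using hxU x (mem_of_mem_nhds hU) z h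

section Equicontinuity

variable {G : Type v} [Group G] {X : Type u} [MetricSpace X] [CompactSpace X] [MulAction G X]
  [ContinuousConstSMul G X] [MulAction.IsMinimal G X]

/-- With an invariant probability measure, a pairwise IP*-equicontinuity point is fixed by all
idempotent ultrafilters. -/
theorem IsPairwiseIPStarEquicontinuousAt.eq_of_tendsto_idempotent [MeasurableSpace X]
    [BorelSpace X] (μ : Measure X) [IsProbabilityMeasure μ] [SMulInvariantMeasure G X μ] {x : X}
    (hx : IsPairwiseIPStarEquicontinuousAt G x) {p : Ultrafilter G} (hp : p * p = p) {y : X}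
    (h : Tendsto (fun g : G => g • x) p (𝓝 y)) : y = x := by
  by_contra hne
  have hε : 0 < dist x y / 3 := by have := dist_pos.2 (Ne.symm hne); positivity
  obtain ⟨U, hU, hxU⟩ := hx _ hε
  obtain ⟨r, hr, hrU⟩ := Metric.nhds_basis_closedBall.mem_iff.1 hU
  let C := Metric.closedBall x (min r (dist x y / 3))
  have hμC : μ C ≠ 0 := by
    -- By minimality an invariant probability measure has full support.
    have hpos := measure_isOpen_pos_of_smulInvariant_of_compact_ne_zero (μ := μ) G
      (isCompact_univ (X := X)) (by simp) (Metric.isOpen_ball (x := x)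
      (ε := min r (dist x y / 3))) ⟨x, Metric.mem_ball_self (lt_min hr hε)⟩
    exact (hpos.trans_le (measure_mono Metric.ball_subset_closedBall)).ne'
  obtain ⟨a, haA, z, hzC, haz⟩ := exists_FP_subset_and_smul_mem μ hp
    (h (Metric.ball_mem_nhds y hε)) Metric.isClosed_closedBall hμC
  have hCU : C ⊆ U := (Metric.closedBall_subset_closedBall (min_le_left _ _)).trans hrU
  -- For this `g`, the point `g • x` is near `y`, `g • z` is near `x`, and the two are close to each
  -- other: three thirds contradict `dist x y`.
  obtain ⟨g, hg, hga⟩ := hxU x (mem_of_mem_nhds hU) z (hCU hzC) (FP a) ⟨a, subset_rfl⟩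
  have h1 : dist (g • x) y < dist x y / 3 := haA hga
  have h2 : dist (g • z) x ≤ dist x y / 3 := le_trans (haz g hga) (min_le_right _ _)
  have h3 : dist (g • x) (g • z) < dist x y / 3 := hg
  have h4 := dist_triangle4 x (g • z) (g • x) y
  rw [dist_comm x (g • z), dist_comm (g • z) (g • x)] at h4
  linarith

/-- Near a pairwise IP*-equicontinuity point fixed by all idempotents, proximal cells are small. -/
theorem IsPairwiseIPStarEquicontinuousAt.exists_nhds_proximal_dist_le {x : X}
    (hx : IsPairwiseIPStarEquicontinuousAt G x)
    (hfix : ∀ p : Ultrafilter G, p * p = p → Tendsto (fun g : G => g • x) p (𝓝 x)) {ε : ℝ}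
    (hε : 0 < ε) : ∃ U ∈ 𝓝 x, ∀ y ∈ U, ∀ z, IsProximalPair G y z → dist z x ≤ ε := by
  obtain ⟨U, hU, hxU⟩ := hx ε hε
  refine ⟨U, hU, fun y hy z hyz => ?_⟩
  obtain ⟨p, hp, hpy, -⟩ := hyz.exists_idempotent
  refine le_of_tendsto (hpy.dist (hfix p hp)) ?_
  filter_upwards [(hxU y hy x (mem_of_mem_nhds hU)).mem_of_idempotent hp] with g hg
  exact le_of_lt hg

variable {x : X} (hx : ∀ ε : ℝ, 0 < ε →
  ∃ U ∈ 𝓝 x, ∀ y ∈ U, ∀ z, IsProximalPair G y z → dist z x ≤ ε)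

include hx

/-- Move the first coordinate of a limit pair towards `x`. Nearby proximal pairs follow, and their
cells are small there, so the second coordinate tends to `x` too. -/
theorem isClosed_setOf_isProximalPair : IsClosed {q : X × X | IsProximalPair G q.1 q.2} := by
  refine isClosed_of_closure_subset ?_
  rintro ⟨a, b⟩ hab
  obtain ⟨p, hpa⟩ := exists_ultrafilter_tendsto_smul (G := G) a x
  obtain ⟨b', hpb⟩ := exists_tendsto_smul_ultrafilter p b
  suffices b' = x from ⟨p, x, hpa, this ▸ hpb⟩
  refine dist_le_zero.1 (le_of_forall_pos_le_add fun ε hε => ?_)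
  obtain ⟨U, hU, hxU⟩ := hx (ε / 2) (by positivity)
  obtain ⟨V, hVU, hV, hxV⟩ := mem_nhds_iff.1 hU
  obtain ⟨g, hga, hgb⟩ := ((hpa.eventually (hV.mem_nhds hxV)).and
    (hpb.eventually (Metric.ball_mem_nhds b' (show (0 : ℝ) < ε / 2 by positivity)))).exists
  have hO : IsOpen {q : X × X | g • q.1 ∈ V ∧ g • q.2 ∈ Metric.ball b' (ε / 2)} :=
    (hV.preimage (continuous_fst.const_smul g)).inter
      (Metric.isOpen_ball.preimage (continuous_snd.const_smul g))
  obtain ⟨⟨c, d⟩, ⟨hc, hd⟩, hcd⟩ := mem_closure_iff.1 hab _ hO ⟨hga, hgb⟩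
  have h1 := hxU _ (hVU hc) _ (IsProximalPair.smul hcd g)
  have h2 : dist (g • d) b' < ε / 2 := hd
  have h3 := dist_triangle_left b' x (g • d)
  linarith

/-- Collapse `a` and `b` to `x`; by closedness the limit of `c` is proximal to `x`, hence equal to
it. -/
theorem IsProximalPair.trans_of_exists_nhds {a b c : X} (hab : IsProximalPair G a b)
    (hbc : IsProximalPair G b c) : IsProximalPair G a c := by
  obtain ⟨p, hpa, hpb⟩ := hab.exists_tendsto x
  obtain ⟨c', hpc⟩ := exists_tendsto_smul_ultrafilter p c
  have hcl : IsProximalPair G x c' :=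
    (isClosed_setOf_isProximalPair hx).mem_of_tendsto (hpb.prodMk_nhds hpc)
      (Eventually.of_forall fun g => hbc.smul g)
  obtain rfl := eq_of_isProximalPair hx hcl
  exact ⟨p, _, hpa, hpc⟩

/-- If proximal cells are small near `x`, then proximality is the kernel of a distal factor. -/
theorem exists_isFactorMap_isDistalSystem_iff_isProximalPair :
    ∃ (Z : Type u) (_ : MetricSpace Z) (_ : CompactSpace Z) (_ : MulAction G Z)
      (_ : ContinuousConstSMul G Z) (φ : X → Z), IsFactorMap G φ ∧ IsDistalSystem G Z ∧
        ∀ a b, φ a = φ b ↔ IsProximalPair G a b := by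
  let s : Setoid X :=
    { r := IsProximalPair G
      iseqv :=
        { refl := fun a =>
            let ⟨p, hp⟩ := exists_ultrafilter_tendsto_smul (G := G) a a
            ⟨p, a, hp, hp⟩
          symm := fun ⟨p, z, ha, hb⟩ => ⟨p, z, hb, ha⟩
          trans := fun hab hbc => hab.trans_of_exists_nhds hx hbc } }
  let Z := Quotient s
  let φ : X → Z := Quotient.mk s
  have hφ : Continuous φ := continuous_quotient_mk'
  have hsurj : Function.Surjective φ := Quotient.exists_rep
  have hiff : ∀ a b, φ a = φ b ↔ IsProximalPair G a b := fun a b => Quotient.eq (r := s)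
  have : T2Space Z := t2Space_quotient_of_isClosed s (isClosed_setOf_isProximalPair hx)
  have : SecondCountableTopology Z :=
    secondCountableTopology_of_continuous_surjective hφ hsurj
  let mZ : MetricSpace Z := TopologicalSpace.metrizableSpaceMetric Z
  let aZ : MulAction G Z :=
    { smul := fun g => Quotient.map (fun a => g • a) fun a b hab => hab.smul g
      one_smul := fun z => by
        obtain ⟨a, rfl⟩ := hsurj z
        exact congrArg φ (one_smul G a)
      mul_smul := fun g h z => by
        obtain ⟨a, rfl⟩ := hsurj z
        exact congrArg φ (mul_smul g h a) }
  have hsmul : ∀ (g : G) (a : X), φ (g • a) = g • φ a := fun _ _ => rfl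
  have sZ : ContinuousConstSMul G Z :=
    ⟨fun g => (IsQuotientMap.of_surjective_continuous hsurj hφ).continuous_iff.2
      (hφ.comp (continuous_const_smul g))⟩
  refine ⟨Z, mZ, inferInstance, aZ, sZ, φ, ⟨hφ, hsurj, hsmul⟩, ?_, hiff⟩
  intro y z hyz
  obtain ⟨a, rfl⟩ := hsurj y
  obtain ⟨b, rfl⟩ := hsurj z
  by_contra hcon
  obtain ⟨p, w, hpa, hpb⟩ := isProximalPair_of_iInf_dist_nonpos hcon
  -- Lift the collapse to `X`: the limits upstairs have the same image, so they are proximal, and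
  -- then so are `a` and `b`.
  obtain ⟨a', ha'⟩ := exists_tendsto_smul_ultrafilter p a
  obtain ⟨b', hb'⟩ := exists_tendsto_smul_ultrafilter p b
  have h1 : φ a' = w := tendsto_nhds_unique ((hφ.tendsto a').comp ha') hpa
  have h2 : φ b' = w := tendsto_nhds_unique ((hφ.tendsto b').comp hb') hpb
  exact hyz ((hiff a b).2 (.of_tendsto ha' hb' ((hiff a' b').1 (h1.trans h2.symm))))

end Equicontinuity

/-! ### From a trivial distal cell to equicontinuity, and the equivalence. -/

/-- A point whose cell in the kernel of a distal factor is trivial is pairwise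
IP*-equicontinuous. -/
theorem IsFactorMap.isPairwiseIPStarEquicontinuousAt {G : Type v} [Group G] {X Y : Type u}
    [MetricSpace X] [CompactSpace X] [MulAction G X] [ContinuousConstSMul G X]
    [MetricSpace Y] [CompactSpace Y] [MulAction G Y] [ContinuousConstSMul G Y] {π : X → Y}
    (hπ : IsFactorMap G π) (hY : IsDistalSystem G Y) {x : X} (hx : ∀ y, π x = π y → y = x) :
    IsPairwiseIPStarEquicontinuousAt G x := by
  intro ε hε
  have hK : IsClosed (π '' (Metric.ball x (ε / 2))ᶜ) :=
    hπ.continuous.isClosedMap _ Metric.isOpen_ball.isClosed_compl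
  have hxK : π x ∉ π '' (Metric.ball x (ε / 2))ᶜ := by
    rintro ⟨y, hy, hyx⟩
    rw [hx y hyx.symm] at hy
    exact hy (Metric.mem_ball_self (half_pos hε))
  refine ⟨π ⁻¹' (π '' (Metric.ball x (ε / 2))ᶜ)ᶜ,
    (hK.isOpen_compl.preimage hπ.continuous).mem_nhds hxK, fun y hy z hz => ?_⟩
  refine isIPStarSet_of_forall_idempotent fun p hp => ?_
  -- The limit of `w` stays in the fibre of `w`, which lies entirely in the ball.
  have key : ∀ w, π w ∉ π '' (Metric.ball x (ε / 2))ᶜ → ∃ w',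
      Tendsto (fun g : G => g • w) p (𝓝 w') ∧ dist w' x < ε / 2 := by
    intro w hw
    obtain ⟨w', hw'⟩ := exists_tendsto_smul_ultrafilter p w
    refine ⟨w', hw', ?_⟩
    have h1 : Tendsto (fun g : G => g • π w) p (𝓝 (π w')) :=
      ((hπ.continuous.tendsto w').comp hw').congr fun g => hπ.map_smul g w
    by_contra hcon
    exact hw ⟨w', hcon, hY.eq_of_tendsto_idempotent hp h1⟩
  obtain ⟨y', hy', hyx⟩ := key y hy
  obtain ⟨z', hz', hzx⟩ := key z hz
  have hlt : dist y' z' < ε := by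
    have := dist_triangle_right y' z' x
    linarith
  exact (hy'.dist hz').eventually (gt_mem_nhds hlt)

theorem mainTheorem12 {G : Type v} [Group G] [Infinite G]
    {X : Type u} [MetricSpace X] [CompactSpace X] [MulAction G X] [ContinuousConstSMul G X]
    [MulAction.IsMinimal G X] [MeasurableSpace X] [BorelSpace X]
    (hμ : ∃ μ : Measure X, IsProbabilityMeasure μ ∧ SMulInvariantMeasure G X μ) (x : X) :
    IsPairwiseIPStarEquicontinuousAt G x ↔ {y : X | (distalStructureRelation G X) x y} = {x} := by
  constructor
  · intro hx
    obtain ⟨μ, _, _⟩ := hμ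
    have hfix : ∀ p : Ultrafilter G, p * p = p → Tendsto (fun g : G => g • x) p (𝓝 x) := by
      intro p hp
      obtain ⟨y, hy⟩ := exists_tendsto_smul_ultrafilter p x
      exact hx.eq_of_tendsto_idempotent μ hp hy ▸ hy
    have hcell : ∀ ε : ℝ, 0 < ε →
        ∃ U ∈ 𝓝 x, ∀ y ∈ U, ∀ z, IsProximalPair G y z → dist z x ≤ ε :=
      fun ε hε => hx.exists_nhds_proximal_dist_le hfix hε
    obtain ⟨Z, _, _, _, _, φ, hφ, hZ, hiff⟩ :=
      exists_isFactorMap_isDistalSystem_iff_isProximalPair hcell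
    refine Set.eq_singleton_iff_unique_mem.2 ⟨(distalStructureRelation G X).refl x, ?_⟩
    intro y hy
    exact eq_of_isProximalPair hcell ((hiff x y).1 (hy Z φ hφ hZ))
  · intro hx
    obtain ⟨Y, _, _, _, _, π, hπ, hrel⟩ := exists_isMaximalDistalFactor G X
    exact hπ.1.isPairwiseIPStarEquicontinuousAt hπ.2.1
      fun y hy => (Set.ext_iff.1 hx y).1 ((hrel x y).2 hy)
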